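/- **Language.** Let $\mathrm{Prop}$ be a set of propositional variables. The language $\mathcal L_{CP}$ of ceteris paribus counterfactuals has the formulas $\phi ::= p \mid \bot \mid \neg\phi \mid \phi\vee\psi \mid [\phi,\Gamma]\psi$, where $p\in\mathrm{Prop}$ and $\Gamma$ is a finite set of previously constructed formulas. The connectives $\wedge,\to,\leftrightarrow,\top$ are defined from $\bot,\neg,\vee$ as usual. **Frames.** A *conditional frame* (with the limit assumption) consists of a non-empty set $W$ and, for each $w\in W$, a set $W_w\subseteq W$ with $w\in W_w$ and a reflexive, transitive, total relation $\preceq_w$ on $W_w$ such that $w\prec_w v$ for all $v\in W_w\setminus\{w\}$ and every non-empty subset of $W_w$ has a $\preceq_w$-minimal element. (For any relation, $u\prec v$ means $u\preceq v$ and not $v\preceq u$.) Let $\mathfrak C$ be the class of conditional frames. A model adds a valuation $V:\mathrm{Prop}\to\mathcal P(W)$. **Semantics.** There are three semantics $X\in\{CP,NC,MS\}$. Variables and Boolean connectives are interpreted as usual. The formula $[\phi,\Gamma]\psi$ is true at $w$ iff every element of $D$ that satisfies $\phi$, and is minimal among these with respect to the relation $R$ on $D$, satisfies $\psi$. With $A(u)=\{\gamma\in\Gamma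 : \gamma \text{ has the same truth value at } u \text{ and at } w\}$, the pair $(D,R)$ is as follows. * $CP$ (strict agreement): $D=\{u\in W_w : A(u)=\Gamma\}$ and $R$ is the restriction of $\preceq_w$ to $D$. * $NC$ (naïve counting): $D=W_w$ and $u\mathrel{R}v$ iff $|A(u)|>|A(v)|$, or $|A(u)|=|A(v)|$ and $u\preceq_w v$. * $MS$ (maximal supersets): $D=W_w$ and $u\mathrel{R}v$ iff $A(u)\supsetneq A(v)$, or $A(u)=A(v)$ and $u\preceq_w v$. Let $\Lambda^{\mathcal L_{CP}}_{\mathfrak C}(X)$ be the set of $\mathcal L_{CP}$-formulas that are true under the semantics $X$ at every world of every model based on a frame in $\mathfrak C$. **Axiom system.** In $\mathcal L_{CP}$ write $\phi\mathrel{\Box\!\!\to}\psi$ for $[\phi,\emptyset]\psi$ and define comparative possibility by $$\phi\preceq\psi := \big((\phi\vee\psi)\mathrel{\Box\!\!\to}\bot\big)\vee\neg\big((\phi\vee\psi)\mathrel{\Box\!\!\to}\neg\phi\big),\qquad \phi\prec\psi:=\neg(\psi\preceq\phi),\qquad \Diamond\phi:=\phi\prec\bot .$$ For formulas $\chi,\psi$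 put $c(\chi,\psi):=\Diamond\chi\to(\chi\wedge\psi)\prec(\chi\wedge\neg\psi)$. For $s,t\subseteq\Gamma$ let $\Gamma_{s,t}$ be the conjunction of all $\gamma\in t\cap s$ and all $\neg\gamma$ with $\gamma\in t\setminus s$. The Hilbert system $\vdash_X$ has Lewis's axioms and rules of VC for comparative possibility, for all formulas of $\mathcal L_{CP}$: * all instances of truth-functional tautologies; * $(\phi\preceq\psi\wedge\psi\preceq\chi)\to\phi\preceq\chi$; * $\phi\preceq\psi\vee\psi\preceq\phi$; * $(\phi\wedge\neg\psi)\to\phi\prec\psi$; * modus ponens; * for $n\ge1$: from $\phi\to(\psi_1\vee\dots\vee\psi_n)$ infer $(\psi_1\preceq\phi)\vee\dots\vee(\psi_n\preceq\phi)$. It has in addition the reduction axiom $[\phi,\Gamma]\psi\leftrightarrow\bigwedge_{s\subseteq\Gamma}\big(\Gamma_{s,\Gamma}\to\rho^X_s\big)$, where $$\rho^{CP}_s=c(\phi\wedge\Gamma_{s,\Gamma},\psi),$$ $$\rho^{MS}_s=\bigwedge_{t\subseteq\Gamma}\Big(\bigwedge_{t\subsetneq t'\subseteq\Gamma}\neg\Diamond(\phi\wedge\Gamma_{s,t'})\to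 c(\phi\wedge\Gamma_{s,t},\psi)\Big),$$ $$\rho^{NC}_s=\bigwedge_{t\subseteq\Gamma}\Big(\bigwedge_{t'\subseteq\Gamma,\,|t'|>|t|}\neg\Diamond(\phi\wedge\Gamma_{s,t'})\to c\big(\phi\wedge\textstyle\bigvee_{t'\subseteq\Gamma,\,|t'|=|t|}\Gamma_{s,t'},\ \psi\big)\Big).$$ **Corollary.** For each $X\in\{CP,NC,MS\}$ the logic $\Lambda^{\mathcal L_{CP}}_{\mathfrak C}(X)$ is completely axiomatised by this system: for every $\phi\in\mathcal L_{CP}$, $$\vdash_X\phi\quad\Longleftrightarrow\quad\phi\in\Lambda^{\mathcal L_{CP}}_{\mathfrak C}(X).$$ -/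

import Mathlib

universe u v

namespace CeterisParibus

/-! ### The language

`Raw` presents ceteris paribus clauses as lists. `Raw.Same` is the congruence that makes the lists
into sets, at every depth, and `Form` is the resulting language, in which the clause `Γ` of
`[φ, Γ]ψ` is a genuine finite set of formulas. -/

inductive Raw (P : Type u) : Type u
  | var (p : P) : Raw P
  | bot : Raw P
  | neg (φ : Raw P) : Raw P
  | or (φ ψ : Raw P) : Raw P
  | cond (φ : Raw P) (Γ : List (Raw P)) (ψ : Raw P) : Raw P

inductive Raw.Same {P : Type u} : Raw P → Raw P → Prop
  | refl (φ) : Raw.Same φ φ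
  | symm {φ ψ} : Raw.Same φ ψ → Raw.Same ψ φ
  | trans {φ ψ χ} : Raw.Same φ ψ → Raw.Same ψ χ → Raw.Same φ χ
  | neg {φ φ'} : Raw.Same φ φ' → Raw.Same (.neg φ) (.neg φ')
  | or {φ φ' ψ ψ'} : Raw.Same φ φ' → Raw.Same ψ ψ' → Raw.Same (.or φ ψ) (.or φ' ψ')
  | cond {φ φ' ψ ψ'} (Γ) : Raw.Same φ φ' → Raw.Same ψ ψ' →
      Raw.Same (.cond φ Γ ψ) (.cond φ' Γ ψ')
  | clauseSet {φ ψ Γ Δ} : (∀ γ, γ ∈ Γ ↔ γ ∈ Δ) → Raw.Same (.cond φ Γ ψ) (.cond φ Δ ψ)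
  | clauseMember {φ ψ γ δ} (Γ) : Raw.Same γ δ →
      Raw.Same (.cond φ (γ :: Γ) ψ) (.cond φ (δ :: Γ) ψ)

instance Raw.setoid (P : Type u) : Setoid (Raw P) :=
  ⟨Raw.Same, ⟨Raw.Same.refl, Raw.Same.symm, Raw.Same.trans⟩⟩

/-- Formulas `p | ⊥ | ¬φ | φ ∨ ψ | [φ, Γ]ψ` with `Γ` a finite set of formulas. -/
def Form (P : Type u) : Type u := Quotient (Raw.setoid P)

namespace Form

variable {P : Type u}

def mk (φ : Raw P) : Form P := Quotient.mk _ φ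

noncomputable def toRaw (φ : Form P) : Raw P := Quotient.out φ

theorem mk_toRaw (φ : Form P) : mk φ.toRaw = φ := Quotient.out_eq φ

def var (p : P) : Form P := mk (.var p)

def bot : Form P := mk .bot

noncomputable def neg (φ : Form P) : Form P := mk (.neg φ.toRaw)

noncomputable def or (φ ψ : Form P) : Form P := mk (.or φ.toRaw ψ.toRaw)

/-- The conditional `[φ, Γ]ψ`. -/
noncomputable def cond (φ : Form P) (Γ : Finset (Form P)) (ψ : Form P) : Form P :=
  mk (.cond φ.toRaw (Γ.toList.map toRaw) ψ.toRaw)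

theorem toRaw_mk (φ : Raw P) : Raw.Same (mk φ).toRaw φ := Quotient.mk_out (s := Raw.setoid P) φ

theorem mk_neg (φ : Raw P) : mk (.neg φ) = neg (mk φ) :=
  Quotient.sound (.neg (.symm (toRaw_mk φ)))

theorem mk_or (φ ψ : Raw P) : mk (.or φ ψ) = or (mk φ) (mk ψ) :=
  Quotient.sound (.or (.symm (toRaw_mk φ)) (.symm (toRaw_mk ψ)))

theorem same_cond_toRaw (φ ψ : Raw P) (Γ Δ : List (Raw P)) :
    Raw.Same (.cond φ (Γ ++ Δ) ψ) (.cond φ (Γ.map (fun γ => (mk γ).toRaw) ++ Δ) ψ) := by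
  induction Γ generalizing Δ with
  | nil => exact .refl _
  | cons γ Γ ih =>
    refine .trans (.clauseMember (Γ ++ Δ) (.symm (toRaw_mk γ))) ?_
    refine .trans (.clauseSet (Δ := Γ ++ ((mk γ).toRaw :: Δ)) ?_) ?_
    · intro x; simp only [List.mem_cons, List.mem_append]; tauto
    · refine .trans (ih _) (.clauseSet ?_)
      intro x; simp only [List.map_cons, List.mem_cons, List.mem_append]; tauto

open Classical in
theorem mk_cond (φ ψ : Raw P) (Γ : List (Raw P)) :
    mk (.cond φ Γ ψ) = cond (mk φ) (Γ.map mk).toFinset (mk ψ) := by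
  refine Quotient.sound ?_
  have h := same_cond_toRaw φ ψ Γ []
  rw [List.append_nil, List.append_nil] at h
  refine .trans h (.trans (.cond _ (.symm (toRaw_mk φ)) (.symm (toRaw_mk ψ))) (.clauseSet ?_))
  intro x
  simp

/-- The language is generated by its constructors. -/
theorem induction {motive : Form P → Prop} (var : ∀ p, motive (var p)) (bot : motive bot)
    (neg : ∀ φ, motive φ → motive (neg φ))
    (or : ∀ φ ψ, motive φ → motive ψ → motive (or φ ψ))
    (cond : ∀ φ Γ ψ, motive φ → (∀ γ ∈ Γ, motive γ) → motive ψ → motive (cond φ Γ ψ))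
    (φ : Form P) : motive φ := by
  classical
  suffices h : ∀ r : Raw P, motive (mk r) by rw [← mk_toRaw φ]; exact h _
  intro r
  induction r using Raw.rec (motive_2 := fun Γ => ∀ γ ∈ Γ, motive (mk γ)) with
  | var p => exact var p
  | bot => exact bot
  | neg φ ih => rw [mk_neg]; exact neg _ ih
  | or φ ψ ih₁ ih₂ => rw [mk_or]; exact or _ _ ih₁ ih₂
  | cond φ Γ ψ ih₁ ih₂ ih₃ =>
    rw [mk_cond]
    refine cond _ _ _ ih₁ ?_ ih₃
    intro γ hγ
    simp only [List.mem_toFinset, List.mem_map] at hγ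
    obtain ⟨δ, hδ, rfl⟩ := hγ
    exact ih₂ δ hδ
  | nil => simp at *
  | cons γ Γ ih₁ ih₂ =>
    rename_i δ hδ
    rcases List.mem_cons.1 hδ with rfl | hδ
    · exact ih₁
    · exact ih₂ δ hδ

end Form

/-! ### Frames and semantics -/

/-- The minimal elements of `S` with respect to a relation `R` whose field is `D`. -/
def Min {W : Type v} (D : Set W) (R : W → W → Prop) (S : Set W) : Set W :=
  {x | x ∈ S ∩ D ∧ ∀ y ∈ S ∩ D, ¬ (R y x ∧ ¬ R x y)}

/-- Conditional frames satisfying the limit assumption; `dom w` is the set `W_w` of worlds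
entertainable from `w`, and `le w` is the similarity order of `w`. -/
structure ConditionalFrame (W : Type v) where
  dom : W → Set W
  le : W → W → W → Prop
  le_dom : ∀ w x y, le w x y → x ∈ dom w ∧ y ∈ dom w
  self_mem : ∀ w, w ∈ dom w
  refl : ∀ w, ∀ x ∈ dom w, le w x x
  trans : ∀ w x y z, le w x y → le w y z → le w x z
  total : ∀ w, ∀ x ∈ dom w, ∀ y ∈ dom w, le w x y ∨ le w y x
  centered : ∀ w, ∀ x ∈ dom w, x ≠ w → le w w x ∧ ¬ le w x w
  limit : ∀ w, ∀ S : Set W, S ⊆ dom w → S.Nonempty → (Min (dom w) (le w) S).Nonempty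

/-- Strict agreement, naive counting, maximal supersets. -/
inductive Semantics
  | CP
  | NC
  | MS

/-- The members of the clause `Γ` on which `x` and `y` agree, where `T γ` is the truth set of
`γ`. -/
def agreement {ι : Type u} {W : Type v} (Γ : Set ι) (T : ι → Set W) (x y : W) : Set ι :=
  {γ ∈ Γ | x ∈ T γ ↔ y ∈ T γ}

/-- The field of the updated similarity order of `w`: the set of entertainable worlds that
agree with `w` on all of `Γ` for strict agreement, and all entertainable worlds otherwise. -/
def updatedDom {ι : Type u} {W : Type v} (F : ConditionalFrame W) (Γ : Set ι) (T : ι → Set W)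
    (w : W) : Semantics → Set W
  | .CP => {x ∈ F.dom w | ∀ γ ∈ Γ, w ∈ T γ ↔ x ∈ T γ}
  | .NC => F.dom w
  | .MS => F.dom w

/-- The updated similarity order of `w`, a relation on `updatedDom`. -/
def updatedLe {ι : Type u} {W : Type v} (F : ConditionalFrame W) (Γ : Set ι) (T : ι → Set W)
    (w : W) : Semantics → W → W → Prop
  | .CP, x, y => F.le w x y
  | .NC, x, y =>
      (agreement Γ T y w).ncard < (agreement Γ T x w).ncard ∨
        ((agreement Γ T x w).ncard = (agreement Γ T y w).ncard ∧ F.le w x y)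
  | .MS, x, y =>
      agreement Γ T y w ⊂ agreement Γ T x w ∨
        (agreement Γ T y w = agreement Γ T x w ∧ F.le w x y)

/-- The truth set of `[φ, Γ]ψ`, where `A`, `B` are the truth sets of `φ`, `ψ`. -/
def condTruth {ι : Type u} {W : Type v} (X : Semantics) (F : ConditionalFrame W)
    (Γ : Set ι) (T : ι → Set W) (A B : Set W) : Set W :=
  {w | Min (updatedDom F Γ T w X) (updatedLe F Γ T w X) A ⊆ B}

mutual

/-- Truth sets of presentations of formulas. The clause is handed over as the set of formulas it
presents, each paired with its truth set. -/
def Raw.truth {P : Type u} {W : Type v} (X : Semantics) (F : ConditionalFrame W)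
    (V : P → Set W) : Raw P → Set W
  | .var p => V p
  | .bot => ∅
  | .neg φ => (Raw.truth X F V φ)ᶜ
  | .or φ ψ => Raw.truth X F V φ ∪ Raw.truth X F V ψ
  | .cond φ Γ ψ =>
      condTruth X F {x : Form P × Set W | x ∈ (Γ.map Form.mk).zip (Raw.truths X F V Γ)} Prod.snd
        (Raw.truth X F V φ) (Raw.truth X F V ψ)

def Raw.truths {P : Type u} {W : Type v} (X : Semantics) (F : ConditionalFrame W)
    (V : P → Set W) : List (Raw P) → List (Set W)
  | [] => []
  | γ :: Γ => Raw.truth X F V γ :: Raw.truths X F V Γ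

end

theorem Raw.mem_zip_truths {P : Type u} {W : Type v} (X : Semantics) (F : ConditionalFrame W)
    (V : P → Set W) (Γ : List (Raw P)) (x : Form P × Set W) :
    x ∈ (Γ.map Form.mk).zip (Raw.truths X F V Γ) ↔
      ∃ γ ∈ Γ, (Form.mk γ, Raw.truth X F V γ) = x := by
  induction Γ with
  | nil => simp [Raw.truths]
  | cons γ Γ ih =>
    simp only [Raw.truths, List.map_cons, List.zip_cons_cons, List.mem_cons, ih]
    constructor
    · rintro (rfl | ⟨δ, hδ, rfl⟩)
      · exact ⟨γ, .inl rfl, rfl⟩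
      · exact ⟨δ, .inr hδ, rfl⟩
    · rintro ⟨δ, rfl | hδ, rfl⟩
      · exact .inl rfl
      · exact .inr ⟨δ, hδ, rfl⟩

theorem Raw.Same.truth_eq {P : Type u} {W : Type v} (X : Semantics) (F : ConditionalFrame W)
    (V : P → Set W) {φ ψ : Raw P} (h : Raw.Same φ ψ) :
    Raw.truth X F V φ = Raw.truth X F V ψ := by
  induction h with
  | refl => rfl
  | symm _ ih => exact ih.symm
  | trans _ _ ih₁ ih₂ => exact ih₁.trans ih₂
  | neg _ ih => simp only [Raw.truth, ih]
  | or _ _ ih₁ ih₂ => simp only [Raw.truth, ih₁, ih₂]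
  | cond _ _ _ ih₁ ih₂ => simp only [Raw.truth, ih₁, ih₂]
  | @clauseSet φ ψ Γ Δ h =>
    simp only [Raw.truth, Raw.mem_zip_truths, h]
  | @clauseMember φ ψ γ δ Γ h ih =>
    have : Form.mk γ = Form.mk δ := Quotient.sound h
    simp only [Raw.truth, Raw.truths, List.map_cons, this, ih]

/-- The truth set of a formula in the model `(F, V)`. -/
def Form.truth {P : Type u} {W : Type v} (X : Semantics) (F : ConditionalFrame W)
    (V : P → Set W) (φ : Form P) : Set W :=
  Quotient.lift (Raw.truth X F V) (fun _ _ h => Raw.Same.truth_eq X F V h) φ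

/-! The clauses that determine `Form.truth`. -/

section Truth

variable {P : Type u} {W : Type v} (X : Semantics) (F : ConditionalFrame W) (V : P → Set W)

theorem Form.truth_mk (φ : Raw P) : (Form.mk φ).truth X F V = Raw.truth X F V φ := rfl

theorem Form.truth_toRaw (φ : Form P) : Raw.truth X F V φ.toRaw = φ.truth X F V := by
  conv_rhs => rw [← Form.mk_toRaw φ]
  rfl

theorem Form.truth_var (p : P) : (Form.var p).truth X F V = V p := by
  rw [Form.var, Form.truth_mk, Raw.truth]

theorem Form.truth_bot : (Form.bot : Form P).truth X F V = ∅ := by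
  rw [Form.bot, Form.truth_mk, Raw.truth]

theorem Form.truth_neg (φ : Form P) : φ.neg.truth X F V = (φ.truth X F V)ᶜ := by
  rw [Form.neg, Form.truth_mk, Raw.truth, Form.truth_toRaw]

theorem Form.truth_or (φ ψ : Form P) :
    (φ.or ψ).truth X F V = φ.truth X F V ∪ ψ.truth X F V := by
  rw [Form.or, Form.truth_mk, Raw.truth, Form.truth_toRaw, Form.truth_toRaw]

theorem condTruth_image {ι : Type u} {κ : Type (max u v)} (e : ι → κ) (he : e.Injective)
    (Γ : Set ι) (T : ι → Set W) (T' : κ → Set W) (hT : ∀ i, T' (e i) = T i) (A B : Set W) :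
    condTruth X F (e '' Γ) T' A B = condTruth X F Γ T A B := by
  have hag : ∀ x y, agreement (e '' Γ) T' x y = e '' agreement Γ T x y := by
    intro x y
    ext k
    constructor
    · rintro ⟨⟨i, hi, rfl⟩, h⟩
      exact ⟨i, ⟨hi, by simpa only [hT] using h⟩, rfl⟩
    · rintro ⟨i, ⟨hi, h⟩, rfl⟩
      exact ⟨⟨i, hi, rfl⟩, by simpa only [hT] using h⟩
  have hss : ∀ s t : Set ι, e '' s ⊂ e '' t ↔ s ⊂ t := by
    intro s t
    simp only [ssubset_iff_subset_not_subset, Set.image_subset_image_iff he]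
  have hdom : ∀ w, updatedDom F (e '' Γ) T' w X = updatedDom F Γ T w X := by
    intro w
    cases X <;> simp [updatedDom, hT]
  have hle : ∀ w, updatedLe F (e '' Γ) T' w X = updatedLe F Γ T w X := by
    intro w
    funext x y
    cases X
    · rfl
    · simp only [updatedLe, hag, Set.ncard_image_of_injective _ he]
    · simp only [updatedLe, hag, hss, he.image_injective.eq_iff]
  simp only [condTruth, hdom, hle]

theorem Form.truth_cond (φ : Form P) (Γ : Finset (Form P)) (ψ : Form P) :
    (Form.cond φ Γ ψ).truth X F V =
      condTruth X F (Γ : Set (Form P)) (Form.truth X F V) (φ.truth X F V) (ψ.truth X F V) := by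
  rw [Form.cond, Form.truth_mk, Raw.truth, Form.truth_toRaw, Form.truth_toRaw]
  have hc : {x : Form P × Set W | x ∈ ((Γ.toList.map Form.toRaw).map Form.mk).zip
      (Raw.truths X F V (Γ.toList.map Form.toRaw))} =
      (fun γ : Form P => (γ, γ.truth X F V)) '' (Γ : Set (Form P)) := by
    ext x
    rw [Set.mem_ofPred_eq, Raw.mem_zip_truths]
    simp [Form.mk_toRaw, Form.truth_toRaw]
  rw [hc]
  exact condTruth_image X F _ (fun a b h => (Prod.ext_iff.1 h).1) _ _ _ (fun _ => rfl) _ _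

end Truth

/-- The logic of ceteris paribus counterfactuals over the class of conditional frames: the set of
formulas true at every world of every model based on a conditional frame. -/
def logic (P : Type u) (X : Semantics) : Set (Form P) :=
  {φ | ∀ (W : Type v) [Nonempty W] (F : ConditionalFrame W) (V : P → Set W) (w : W),
    w ∈ φ.truth X F V}

/-! ### The axiom system -/

namespace Form

variable {P : Type u}

noncomputable def top : Form P := neg bot

noncomputable def and (φ ψ : Form P) : Form P := neg (or (neg φ) (neg ψ))

noncomputable def imp (φ ψ : Form P) : Form P := or (neg φ) ψ

noncomputable def iff (φ ψ : Form P) : Form P := and (imp φ ψ) (imp ψ φ)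

/-- Finite conjunctions. -/
noncomputable def conj (l : List (Form P)) : Form P := l.foldr and top

/-- Finite disjunctions. -/
noncomputable def disj (l : List (Form P)) : Form P := l.foldr or bot

/-- The ordinary counterfactual `φ □→ ψ`. -/
noncomputable def would (φ ψ : Form P) : Form P := cond φ ∅ ψ

/-- Comparative possibility `φ ≼ ψ`, by Lewis's definition from the counterfactual. -/
noncomputable def le (φ ψ : Form P) : Form P :=
  or (would (or φ ψ) bot) (neg (would (or φ ψ) (neg φ)))

/-- Strict comparative possibility `φ ≺ ψ`. -/
noncomputable def lt (φ ψ : Form P) : Form P := neg (le ψ φ)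

/-- Outer possibility `◇φ`. -/
noncomputable def dia (φ : Form P) : Form P := lt φ bot

/-- The counterfactual with antecedent `χ` and consequent `ψ`, in terms of comparative
possibility: `◇χ → (χ ∧ ψ) ≺ (χ ∧ ¬ψ)`. -/
noncomputable def compWould (χ ψ : Form P) : Form P :=
  imp (dia χ) (lt (and χ ψ) (and χ (neg ψ)))

open Classical in
/-- For `s, t ⊆ Γ`, the conjunction over `γ ∈ t` of `γ` if `γ ∈ s` and of `¬γ` if `γ ∉ s`. With
`t = Γ` this describes a world at which exactly the members `s` of `Γ` are true; for general `t`
it expresses agreement on (at least) `t` with such a world. -/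
noncomputable def agree (s t : Finset (Form P)) : Form P :=
  conj (t.toList.map fun γ => if γ ∈ s then γ else neg γ)

open Classical in
/-- The comparative possibility formula to which `[φ, Γ]ψ` reduces. -/
noncomputable def reduct (X : Semantics) (φ : Form P) (Γ : Finset (Form P)) (ψ : Form P) :
    Form P :=
  conj (Γ.powerset.toList.map fun s => imp (agree s Γ)
    (match X with
      | .CP => compWould (and φ (agree s Γ)) ψ
      | .NC => conj (Γ.powerset.toList.map fun t => imp
          (conj ((Γ.powerset.filter fun t' => t.card < t'.card).toList.map fun t' =>
            neg (dia (and φ (agree s t')))))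
          (compWould (and φ
            (disj ((Γ.powerset.filter fun t' => t'.card = t.card).toList.map fun t' =>
              agree s t'))) ψ))
      | .MS => conj (Γ.powerset.toList.map fun t => imp
          (conj ((Γ.powerset.filter fun t' => t ⊂ t').toList.map fun t' =>
            neg (dia (and φ (agree s t')))))
          (compWould (and φ (agree s t)) ψ))))

/-- Instances of truth-functional tautologies. -/
def IsTautology (φ : Form P) : Prop :=
  ∀ v : Form P → Prop, ¬ v bot → (∀ α, v (neg α) ↔ ¬ v α) →
    (∀ α β, v (or α β) ↔ v α ∨ v β) → v φ

end Form

open Form in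
/-- Derivability in the Hilbert system that consists of Lewis's system VC for comparative
possibility and, for the given semantics, the reduction axiom for `[φ, Γ]ψ`. -/
inductive Derivable {P : Type u} (X : Semantics) : Form P → Prop
  | tautology {φ} : IsTautology φ → Derivable X φ
  | transitivity (φ ψ χ) : Derivable X (imp (and (le φ ψ) (le ψ χ)) (le φ χ))
  | connexivity (φ ψ) : Derivable X (or (le φ ψ) (le ψ φ))
  | centering (φ ψ) : Derivable X (imp (and φ (neg ψ)) (lt φ ψ))
  | reduction (φ Γ ψ) : Derivable X (iff (Form.cond φ Γ ψ) (reduct X φ Γ ψ))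
  | modusPonens {φ ψ} : Derivable X (imp φ ψ) → Derivable X φ → Derivable X ψ
  | comparative {φ} (l : List (Form P)) : l ≠ [] → Derivable X (imp φ (disj l)) →
      Derivable X (disj (l.map fun ψ => le ψ φ))

end CeterisParibus

/-!
Soundness is an induction on derivations. The case that matters is the reduction axiom: under each
of the three semantics the conditional `[φ, Γ]ψ` and its reduct have the same truth set in every
model (`truth_reduct`). At a world `w` only the index `s` that lists the members of `Γ` true at `w`
counts, and minimization in the updated order amounts to ordinary minimization at each maximal
degree of agreement with `w` (`min_superset_subset_iff`, `min_card_subset_iff`).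

Completeness needs no translation into the language of comparative possibility. For a finite set
`S` of formulas, the worlds of the canonical model are the finitely many ways in which a maximal
consistent theory can decide `S`, each represented by one theory `m w`. The world `x` is at least
as similar to `w` as `y` is when `m w` contains `δ x ≼ δ y`, where `δ` is the description of the
decisions made on `S`. The axioms of VC make this a conditional frame, and finiteness gives the
limit assumption. If `φ` and `ψ` are Boolean combinations of members of `S`, then they are
equivalent to disjunctions of such descriptions, and the rule of comparative possibility yields
the truth lemma for `φ ≼ ψ` (`TruthLemma.le`). Since the reduct of `[φ, Γ]ψ` is a Boolean
combination of these, it satisfies the truth lemma as well, and `[φ, Γ]ψ` inherits it because it is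
equivalent to its reduct both in the theory `m w`, by the reduction axiom, and in the model, by
`truth_reduct`.

The canonical model is finite, so it has a copy in every universe, whatever the number of
propositional variables.
-/

namespace CeterisParibus

/-! ### Truth of the defined connectives -/

section Semantics

open Form

variable {P : Type u} {W : Type v} {X : Semantics} {F : ConditionalFrame W} {V : P → Set W}
  {w : W} {φ ψ χ : Form P}

theorem mem_truth_neg : w ∈ φ.neg.truth X F V ↔ w ∉ φ.truth X F V := by
  rw [truth_neg]; rfl

theorem mem_truth_or : w ∈ (φ.or ψ).truth X F V ↔ w ∈ φ.truth X F V ∨ w ∈ ψ.truth X F V := by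
  rw [truth_or]; rfl

theorem not_mem_truth_bot : w ∉ (bot : Form P).truth X F V := by
  rw [truth_bot]; exact id

theorem mem_truth_and : w ∈ (φ.and ψ).truth X F V ↔ w ∈ φ.truth X F V ∧ w ∈ ψ.truth X F V := by
  rw [Form.and, mem_truth_neg, mem_truth_or, mem_truth_neg, mem_truth_neg]; tauto

theorem mem_truth_imp : w ∈ (φ.imp ψ).truth X F V ↔ (w ∈ φ.truth X F V → w ∈ ψ.truth X F V) := by
  rw [Form.imp, mem_truth_or, mem_truth_neg]; tauto

theorem mem_truth_iff : w ∈ (φ.iff ψ).truth X F V ↔ (w ∈ φ.truth X F V ↔ w ∈ ψ.truth X F V) := by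
  rw [Form.iff, mem_truth_and, mem_truth_imp, mem_truth_imp]; tauto

theorem mem_truth_conj {l : List (Form P)} :
    w ∈ (conj l).truth X F V ↔ ∀ φ ∈ l, w ∈ φ.truth X F V := by
  induction l with
  | nil => simp [conj, top, mem_truth_neg, not_mem_truth_bot]
  | cons φ l ih =>
    rw [List.forall_mem_cons, ← ih]
    exact mem_truth_and

theorem mem_truth_disj {l : List (Form P)} :
    w ∈ (disj l).truth X F V ↔ ∃ φ ∈ l, w ∈ φ.truth X F V := by
  induction l with
  | nil => simp [disj, not_mem_truth_bot]
  | cons φ l ih =>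
    rw [List.exists_mem_cons_iff, ← ih]
    exact mem_truth_or

theorem mem_truth_conj_map {α : Type*} {S : Finset α} {f : α → Form P} :
    w ∈ (conj (S.toList.map f)).truth X F V ↔ ∀ i ∈ S, w ∈ (f i).truth X F V := by
  simp [mem_truth_conj]

theorem mem_truth_disj_map {α : Type*} {S : Finset α} {f : α → Form P} :
    w ∈ (disj (S.toList.map f)).truth X F V ↔ ∃ i ∈ S, w ∈ (f i).truth X F V := by
  simp [mem_truth_disj]

theorem mem_truth_agree {s t : Finset (Form P)} :
    w ∈ (agree s t).truth X F V ↔ ∀ γ ∈ t, (w ∈ γ.truth X F V ↔ γ ∈ s) := by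
  rw [agree, mem_truth_conj_map]
  refine forall₂_congr fun γ _ => ?_
  split_ifs with h <;> simp [h, mem_truth_neg]

/-- With an empty clause the three semantics coincide. -/
theorem mem_truth_would : w ∈ (would φ ψ).truth X F V ↔
    Min (F.dom w) (F.le w) (φ.truth X F V) ⊆ ψ.truth X F V := by
  rw [would, truth_cond]
  have hdom : updatedDom F (↑(∅ : Finset (Form P))) (Form.truth X F V) w X = F.dom w := by
    cases X <;> simp [updatedDom]
  have hag : ∀ x y, agreement ∅ (Form.truth X F V) x y = ∅ := by
    intro x y; simp [agreement]
  have hle : updatedLe F (↑(∅ : Finset (Form P))) (Form.truth X F V) w X = F.le w := by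
    funext x y
    cases X <;> simp [updatedLe, hag]
  show Min _ _ _ ⊆ _ ↔ _
  rw [hdom, hle]

/-- The limit assumption reduces Lewis's definition of `φ ≼ ψ` to a comparison of worlds. -/
theorem mem_truth_le : w ∈ (le φ ψ).truth X F V ↔
    ∀ y ∈ F.dom w, y ∈ ψ.truth X F V → ∃ x ∈ F.dom w, x ∈ φ.truth X F V ∧ F.le w x y := by
  rw [Form.le, mem_truth_or, mem_truth_neg, mem_truth_would, mem_truth_would, truth_bot,
    truth_neg, truth_or]
  constructor
  · rintro (h | h) y hy hyψ
    · exfalso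
      obtain ⟨z, hz⟩ := F.limit w ((φ.truth X F V ∪ ψ.truth X F V) ∩ F.dom w)
        Set.inter_subset_right ⟨y, .inr hyψ, hy⟩
      exact h ⟨hz.1.1, fun a ha => hz.2 a ⟨ha, ha.2⟩⟩
    · obtain ⟨x, ⟨hx, hmin⟩, hxφ⟩ := Set.not_subset.1 h
      refine ⟨x, hx.2, not_not.1 hxφ, ?_⟩
      have := hmin y ⟨.inr hyψ, hy⟩
      rcases F.total w x hx.2 y hy with h | h <;> tauto
  · intro h
    by_cases hne : ((φ.truth X F V ∪ ψ.truth X F V) ∩ F.dom w).Nonempty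
    · right
      obtain ⟨z, hz⟩ := F.limit w _ Set.inter_subset_right hne
      have hmin : ∀ a ∈ (φ.truth X F V ∪ ψ.truth X F V) ∩ F.dom w, ¬ (F.le w a z ∧ ¬ F.le w z a) :=
        fun a ha => hz.2 a ⟨ha, ha.2⟩
      rcases hz.1.1.1 with hzφ | hzψ
      · exact fun hs => hs ⟨hz.1.1, hmin⟩ hzφ
      · obtain ⟨x, hx, hxφ, hxz⟩ := h z hz.1.2 hzψ
        have hzx := not_and_not_right.1 (hmin x ⟨.inl hxφ, hx⟩) hxz
        exact fun hs => hs ⟨⟨.inl hxφ, hx⟩, fun a ha hax => hmin a ha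
          ⟨F.trans w _ _ _ hax.1 hxz, fun hza => hax.2 (F.trans w _ _ _ hxz hza)⟩⟩ hxφ
    · exact .inl fun x hx => hne ⟨x, hx.1⟩

theorem mem_truth_dia : w ∈ (dia φ).truth X F V ↔ ∃ x ∈ F.dom w, x ∈ φ.truth X F V := by
  rw [dia, lt, mem_truth_neg, mem_truth_le]
  simp [not_mem_truth_bot]

/-- `◇χ → (χ ∧ ψ) ≺ (χ ∧ ¬ψ)` has the truth condition of the counterfactual `χ □→ ψ`. -/
theorem mem_truth_compWould : w ∈ (compWould χ ψ).truth X F V ↔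
    Min (F.dom w) (F.le w) (χ.truth X F V) ⊆ ψ.truth X F V := by
  rw [compWould, mem_truth_imp, mem_truth_dia, lt, mem_truth_neg, mem_truth_le]
  simp only [mem_truth_and, mem_truth_neg, not_forall, not_exists, not_and]
  constructor
  · intro h x ⟨hx, hmin⟩
    by_contra hxψ
    obtain ⟨y, hy, ⟨hyχ, -⟩, hyx⟩ := h ⟨x, hx.2, hx.1⟩
    have h1 := hyx x hx.2 ⟨hx.1, hxψ⟩
    exact hmin y ⟨hyχ, hy⟩ ⟨(F.total w x hx.2 y hy).resolve_left h1, h1⟩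
  · rintro h ⟨x, hx, hxχ⟩
    obtain ⟨z, hz⟩ := F.limit w _ Set.inter_subset_right ⟨x, hxχ, hx⟩
    have hmin : ∀ a ∈ χ.truth X F V ∩ F.dom w, ¬ (F.le w a z ∧ ¬ F.le w z a) :=
      fun a ha => hz.2 a ⟨ha, ha.2⟩
    refine ⟨z, hz.1.2, ⟨hz.1.1.1, h ⟨hz.1.1, hmin⟩⟩, fun a ha haχ haz => haχ.2 ?_⟩
    have hza := not_and_not_right.1 (hmin a ⟨haχ.1, ha⟩) haz
    exact h ⟨⟨haχ.1, ha⟩, fun b hb hba => hmin b hb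
      ⟨F.trans w _ _ _ hba.1 haz, fun hzb => hba.2 (F.trans w _ _ _ haz hzb)⟩⟩

/-! ### Validity of the reduction axiom -/

variable {D A B : Set W} {R : W → W → Prop} {ι : Type*} {Γ : Finset ι} {a : W → Finset ι}

/-- Minimization that first maximizes the set `a x` and then applies `R` may be carried out
separately at each value `t` of `a` above which there are no elements of `A`. -/
theorem min_superset_subset_iff (ha : ∀ x, a x ⊆ Γ) :
    Min D (fun x y => a y ⊂ a x ∨ a y = a x ∧ R x y) A ⊆ B ↔
      ∀ t ⊆ Γ, (∀ t' ⊆ Γ, t ⊂ t' → ¬ ∃ x ∈ D, x ∈ A ∧ t' ⊆ a x) →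
        Min D R {x | x ∈ A ∧ t ⊆ a x} ⊆ B := by
  constructor
  · rintro h t - hmax x ⟨⟨⟨hxA, htx⟩, hxD⟩, hmin⟩
    have hext : ∀ y ∈ D, y ∈ A → t ⊆ a y → t = a y := fun y hyD hyA hty => by
      by_contra hne
      exact hmax _ (ha y) (lt_of_le_of_ne hty hne) ⟨y, hyD, hyA, subset_rfl⟩
    have hx := hext x hxD hxA htx
    refine h ⟨⟨hxA, hxD⟩, ?_⟩
    rintro y ⟨hyA, hyD⟩ ⟨hyx | ⟨hyx, hR⟩, hn⟩
    · exact hyx.ne (hx.symm.trans (hext y hyD hyA (htx.trans hyx.subset)))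
    · exact hmin y ⟨⟨hyA, htx.trans hyx.subset⟩, hyD⟩ ⟨hR, fun hR' => hn (.inr ⟨hyx.symm, hR'⟩)⟩
  · rintro h x ⟨⟨hxA, hxD⟩, hmin⟩
    have hmax : ∀ y ∈ D, y ∈ A → ¬ a x ⊂ a y := fun y hyD hyA hlt =>
      hmin y ⟨hyA, hyD⟩ ⟨.inl hlt, by
        rintro (h' | ⟨h', -⟩)
        · exact lt_asymm hlt h'
        · exact hlt.ne h'.symm⟩
    refine h (a x) (ha x) (fun t' _ hlt ⟨y, hyD, hyA, hty⟩ =>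
      hmax y hyD hyA (lt_of_lt_of_le hlt hty)) ⟨⟨⟨hxA, subset_rfl⟩, hxD⟩, ?_⟩
    rintro y ⟨⟨hyA, hxy⟩, hyD⟩ ⟨hR, hn⟩
    have he : a x = a y := by
      by_contra hne
      exact hmax y hyD hyA (lt_of_le_of_ne hxy hne)
    refine hmin y ⟨hyA, hyD⟩ ⟨.inr ⟨he, hR⟩, ?_⟩
    rintro (h' | ⟨-, h'⟩)
    · exact h'.ne he.symm
    · exact hn h'

/-- The counting analogue of `min_superset_subset_iff`. -/
theorem min_card_subset_iff (ha : ∀ x, a x ⊆ Γ) :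
    Min D (fun x y => (a y).card < (a x).card ∨ (a x).card = (a y).card ∧ R x y) A ⊆ B ↔
      ∀ t ⊆ Γ, (∀ t' ⊆ Γ, t.card < t'.card → ¬ ∃ x ∈ D, x ∈ A ∧ t' ⊆ a x) →
        Min D R {x | x ∈ A ∧ ∃ t' ⊆ Γ, t'.card = t.card ∧ t' ⊆ a x} ⊆ B := by
  constructor
  · rintro h t - hmax x ⟨⟨⟨hxA, t', -, htt, htx⟩, hxD⟩, hmin⟩
    have hle : ∀ y ∈ D, y ∈ A → (a y).card ≤ t.card := fun y hyD hyA => by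
      by_contra hlt
      exact hmax _ (ha y) (not_le.1 hlt) ⟨y, hyD, hyA, subset_rfl⟩
    have hx : (a x).card = t.card := le_antisymm (hle x hxD hxA) (htt ▸ Finset.card_le_card htx)
    refine h ⟨⟨hxA, hxD⟩, ?_⟩
    rintro y ⟨hyA, hyD⟩ ⟨hyx | ⟨hyx, hR⟩, hn⟩
    · have := hle y hyD hyA
      omega
    · exact hmin y ⟨⟨hyA, a y, ha y, hyx.trans hx, subset_rfl⟩, hyD⟩
        ⟨hR, fun hR' => hn (.inr ⟨hyx.symm, hR'⟩)⟩
  · rintro h x ⟨⟨hxA, hxD⟩, hmin⟩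
    have hmax : ∀ y ∈ D, y ∈ A → (a y).card ≤ (a x).card := fun y hyD hyA => by
      by_contra hlt
      exact hmin y ⟨hyA, hyD⟩ ⟨.inl (not_le.1 hlt), by omega⟩
    refine h (a x) (ha x) (fun t' _ hlt ⟨y, hyD, hyA, hty⟩ => absurd (hmax y hyD hyA)
      (not_le.2 (lt_of_lt_of_le hlt (Finset.card_le_card hty))))
      ⟨⟨⟨hxA, a x, ha x, rfl, subset_rfl⟩, hxD⟩, ?_⟩
    rintro y ⟨⟨hyA, t', -, htx, hty⟩, hyD⟩ ⟨hR, hn⟩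
    have he : (a y).card = (a x).card :=
      le_antisymm (hmax y hyD hyA) (htx ▸ Finset.card_le_card hty)
    refine hmin y ⟨hyA, hyD⟩ ⟨.inr ⟨he, hR⟩, ?_⟩
    rintro (h' | ⟨-, h'⟩)
    · omega
    · exact hn h'

/-- A ceteris paribus conditional and its reduct have the same truth set in every model. -/
theorem truth_reduct (φ : Form P) (Γ : Finset (Form P)) (ψ : Form P) :
    (reduct X φ Γ ψ).truth X F V = (cond φ Γ ψ).truth X F V := by
  classical
  ext w
  -- The members of `Γ` true at `w`, the only index whose antecedent `agree s Γ` holds at `w`.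
  set s : Finset (Form P) := Γ.filter fun γ => w ∈ γ.truth X F V with hs
  have hmem : ∀ γ ∈ Γ, (γ ∈ s ↔ w ∈ γ.truth X F V) := fun γ hγ => by simp [hs, hγ]
  have hpick : ∀ ρ : Finset (Form P) → Form P,
      w ∈ (conj (Γ.powerset.toList.map fun s => imp (agree s Γ) (ρ s))).truth X F V ↔
        w ∈ (ρ s).truth X F V := by
    intro ρ
    simp only [mem_truth_conj_map, Finset.mem_powerset, mem_truth_imp]
    constructor
    · exact fun h => h s (Finset.filter_subset _ _)
        (mem_truth_agree.2 fun γ hγ => (hmem γ hγ).symm)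
    · intro h s' hs' hag
      have : s' = s := by
        ext γ
        constructor
        · intro hγ
          exact (hmem γ (hs' hγ)).2 ((mem_truth_agree.1 hag γ (hs' hγ)).2 hγ)
        · intro hγ
          have hγΓ : γ ∈ Γ := Finset.filter_subset _ _ hγ
          exact (mem_truth_agree.1 hag γ hγΓ).1 ((hmem γ hγΓ).1 hγ)
      exact this ▸ h
  let a : W → Finset (Form P) := fun x =>
    Γ.filter fun γ => x ∈ γ.truth X F V ↔ w ∈ γ.truth X F V
  have ha : ∀ x, a x ⊆ Γ := fun x => Finset.filter_subset _ _
  have hag : ∀ x, agreement (Γ : Set (Form P)) (Form.truth X F V) x w = a x := by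
    intro x; ext γ; simp only [a, Finset.coe_filter]; rfl
  have hagree : ∀ t ⊆ Γ, ∀ x, x ∈ (agree s t).truth X F V ↔ t ⊆ a x := by
    intro t ht x
    rw [mem_truth_agree]
    refine forall₂_congr fun γ hγ => ?_
    simp [a, ht hγ, hmem γ (ht hγ)]
  rw [reduct, hpick, truth_cond]
  show _ ↔ Min (updatedDom F _ _ w X) (updatedLe F _ _ w X) _ ⊆ _
  cases X with
  | CP =>
    show w ∈ (compWould _ _).truth _ F V ↔ _
    rw [mem_truth_compWould]
    have : Min (F.dom w) (F.le w) ((φ.and (agree s Γ)).truth .CP F V) =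
        Min (updatedDom F (Γ : Set (Form P)) (Form.truth .CP F V) w .CP) (F.le w)
          (φ.truth .CP F V) := by
      have hD : ((φ.and (agree s Γ)).truth .CP F V) ∩ F.dom w = φ.truth .CP F V ∩
          updatedDom F (Γ : Set (Form P)) (Form.truth .CP F V) w .CP := by
        ext x
        have : x ∈ updatedDom F (Γ : Set (Form P)) (Form.truth .CP F V) w .CP ↔
            x ∈ F.dom w ∧ ∀ γ ∈ (Γ : Set (Form P)), w ∈ γ.truth .CP F V ↔ x ∈ γ.truth .CP F V :=
          Iff.rfl
        rw [Set.mem_inter_iff, Set.mem_inter_iff, this, mem_truth_and, mem_truth_agree]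
        have : (∀ γ ∈ Γ, (x ∈ γ.truth .CP F V ↔ γ ∈ s)) ↔
            ∀ γ ∈ (Γ : Set (Form P)), w ∈ γ.truth .CP F V ↔ x ∈ γ.truth .CP F V :=
          forall₂_congr fun γ hγ => by rw [hmem γ hγ]; tauto
        rw [this]
        tauto
      rw [Min, Min, hD]
    rw [this]
    rfl
  | MS =>
    have hle : updatedLe F (Γ : Set (Form P)) (Form.truth .MS F V) w .MS =
        fun x y => a y ⊂ a x ∨ a y = a x ∧ F.le w x y := by
      funext x y
      simp only [updatedLe, hag, Finset.coe_ssubset, Finset.coe_inj]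
    rw [hle, show updatedDom F (Γ : Set (Form P)) (Form.truth .MS F V) w .MS = F.dom w from rfl,
      min_superset_subset_iff ha]
    simp only [mem_truth_conj_map, Finset.mem_powerset, Finset.mem_filter, and_imp,
      mem_truth_imp, mem_truth_neg, mem_truth_dia, mem_truth_compWould]
    refine forall₂_congr fun t ht => imp_congr (forall₃_congr fun t' ht' _ => ?_) ?_
    · simp only [mem_truth_and, hagree t' ht']
    · have : (φ.and (agree s t)).truth .MS F V = {x | x ∈ φ.truth .MS F V ∧ t ⊆ a x} := by
        ext x
        rw [mem_truth_and, hagree t ht]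
        rfl
      rw [this]
  | NC =>
    have hle : updatedLe F (Γ : Set (Form P)) (Form.truth .NC F V) w .NC =
        fun x y => (a y).card < (a x).card ∨ (a x).card = (a y).card ∧ F.le w x y := by
      funext x y
      simp only [updatedLe, hag, Set.ncard_coe_finset]
    rw [hle, show updatedDom F (Γ : Set (Form P)) (Form.truth .NC F V) w .NC = F.dom w from rfl,
      min_card_subset_iff ha]
    simp only [mem_truth_conj_map, Finset.mem_powerset, Finset.mem_filter, and_imp,
      mem_truth_imp, mem_truth_neg, mem_truth_dia, mem_truth_compWould]
    refine forall₂_congr fun t ht => imp_congr (forall₃_congr fun t' ht' _ => ?_) ?_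
    · simp only [mem_truth_and, hagree t' ht']
    · have : (φ.and (disj ((Γ.powerset.filter fun t' => t'.card = t.card).toList.map fun t' =>
          agree s t'))).truth .NC F V =
            {x | x ∈ φ.truth .NC F V ∧ ∃ t' ⊆ Γ, t'.card = t.card ∧ t' ⊆ a x} := by
        ext x
        rw [mem_truth_and, mem_truth_disj_map]
        simp only [Finset.mem_powerset, Finset.mem_filter]
        refine and_congr_right fun _ => exists_congr fun t' => ?_
        rw [and_assoc]
        exact and_congr_right fun ht' => and_congr_right fun _ => hagree t' ht' x
      rw [this]

/-! ### Soundness -/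

theorem Derivable.sound (h : Derivable X φ) (F : ConditionalFrame W) (V : P → Set W) (w : W) :
    w ∈ φ.truth X F V := by
  induction h generalizing w with
  | tautology h =>
    exact h (fun α => w ∈ α.truth X F V) not_mem_truth_bot (fun _ => mem_truth_neg)
      (fun _ _ => mem_truth_or)
  | transitivity φ ψ χ =>
    rw [mem_truth_imp, mem_truth_and, mem_truth_le, mem_truth_le, mem_truth_le]
    rintro ⟨h₁, h₂⟩ z hz hzχ
    obtain ⟨y, hy, hyψ, hyz⟩ := h₂ z hz hzχ
    obtain ⟨x, hx, hxφ, hxy⟩ := h₁ y hy hyψ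
    exact ⟨x, hx, hxφ, F.trans w _ _ _ hxy hyz⟩
  | connexivity φ ψ =>
    rw [mem_truth_or, mem_truth_le, mem_truth_le]
    by_contra! ⟨⟨y, hy, hyψ, h₁⟩, x, hx, hxφ, h₂⟩
    exact (F.total w x hx y hy).elim (h₁ x hx hxφ) (h₂ y hy hyψ)
  | centering φ ψ =>
    rw [mem_truth_imp, mem_truth_and, lt, mem_truth_neg, mem_truth_neg, mem_truth_le]
    rintro ⟨hφ, hψ⟩ h
    obtain ⟨x, hx, hxψ, hxw⟩ := h w (F.self_mem w) hφ
    exact (F.centered w x hx (fun h => hψ (h ▸ hxψ))).2 hxw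
  | reduction φ Γ ψ =>
    rw [mem_truth_iff, truth_reduct]
  | modusPonens _ _ ih₁ ih₂ => exact mem_truth_imp.1 (ih₁ w) (ih₂ w)
  | @comparative φ l hl _ ih =>
    simp only [mem_truth_imp, mem_truth_disj] at ih
    simp only [mem_truth_disj, List.mem_map, exists_exists_and_eq_and, mem_truth_le]
    by_cases hne : (φ.truth X F V ∩ F.dom w).Nonempty
    · obtain ⟨z, hz⟩ := F.limit w _ Set.inter_subset_right hne
      obtain ⟨ψ, hψ, hzψ⟩ := ih z hz.1.1.1
      refine ⟨ψ, hψ, fun y hy hyφ => ⟨z, hz.1.2, hzψ, ?_⟩⟩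
      have := hz.2 y ⟨⟨hyφ, hy⟩, hy⟩
      rcases F.total w z hz.1.2 y hy with h | h <;> tauto
    · obtain ⟨ψ, hψ⟩ := List.exists_mem_of_ne_nil l hl
      exact ⟨ψ, hψ, fun y hy hyφ => absurd ⟨y, hyφ, hy⟩ hne⟩

end Semantics

/-! ### Maximal consistent theories -/

section Theories

open Form

variable {P : Type u} {X : Semantics} {M : Set (Form P)} {φ ψ χ : Form P}

/-- Maximal consistent theories, described as the Boolean valuations that make all derivable
formulas true. -/
structure IsMaximal (X : Semantics) (M : Set (Form P)) : Prop where
  mem_of_derivable : ∀ {φ}, Derivable X φ → φ ∈ M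
  bot_notMem : bot ∉ M
  neg_mem : ∀ {φ}, neg φ ∈ M ↔ φ ∉ M
  or_mem : ∀ {φ ψ}, Form.or φ ψ ∈ M ↔ φ ∈ M ∨ ψ ∈ M

namespace IsMaximal

variable (hM : IsMaximal X M)

include hM

theorem and_mem : and φ ψ ∈ M ↔ φ ∈ M ∧ ψ ∈ M := by
  rw [Form.and, hM.neg_mem, hM.or_mem, hM.neg_mem, hM.neg_mem]; tauto

theorem imp_mem : imp φ ψ ∈ M ↔ (φ ∈ M → ψ ∈ M) := by
  rw [Form.imp, hM.or_mem, hM.neg_mem]; tauto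

theorem iff_mem : Form.iff φ ψ ∈ M ↔ (φ ∈ M ↔ ψ ∈ M) := by
  rw [Form.iff, hM.and_mem, hM.imp_mem, hM.imp_mem]; tauto

theorem conj_mem {l : List (Form P)} : conj l ∈ M ↔ ∀ φ ∈ l, φ ∈ M := by
  induction l with
  | nil => simp [conj, top, hM.neg_mem, hM.bot_notMem]
  | cons φ l ih =>
    rw [List.forall_mem_cons, ← ih]
    exact hM.and_mem

theorem disj_mem {l : List (Form P)} : disj l ∈ M ↔ ∃ φ ∈ l, φ ∈ M := by
  induction l with
  | nil => simp [disj, hM.bot_notMem]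
  | cons φ l ih =>
    rw [List.exists_mem_cons_iff, ← ih]
    exact hM.or_mem

theorem conj_map_mem {α : Type*} {S : Finset α} {f : α → Form P} :
    conj (S.toList.map f) ∈ M ↔ ∀ i ∈ S, f i ∈ M := by
  simp [hM.conj_mem]

theorem disj_map_mem {α : Type*} {S : Finset α} {f : α → Form P} :
    disj (S.toList.map f) ∈ M ↔ ∃ i ∈ S, f i ∈ M := by
  simp [hM.disj_mem]

theorem agree_mem {s t : Finset (Form P)} : agree s t ∈ M ↔ ∀ γ ∈ t, (γ ∈ M ↔ γ ∈ s) := by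
  rw [agree, hM.conj_map_mem]
  refine forall₂_congr fun γ _ => ?_
  split_ifs with h <;> simp [h, hM.neg_mem]

theorem le_trans_mem (h₁ : le φ ψ ∈ M) (h₂ : le ψ χ ∈ M) : le φ χ ∈ M :=
  hM.imp_mem.1 (hM.mem_of_derivable (.transitivity φ ψ χ)) (hM.and_mem.2 ⟨h₁, h₂⟩)

theorem le_total_mem (φ ψ : Form P) : le φ ψ ∈ M ∨ le ψ φ ∈ M :=
  hM.or_mem.1 (hM.mem_of_derivable (.connexivity φ ψ))

theorem le_notMem_of_mem (hφ : φ ∈ M) (hψ : ψ ∉ M) : le ψ φ ∉ M :=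
  hM.neg_mem.1 (hM.imp_mem.1 (hM.mem_of_derivable (.centering φ ψ))
    (hM.and_mem.2 ⟨hφ, hM.neg_mem.2 hψ⟩))

theorem dia_mem : dia φ ∈ M ↔ le bot φ ∉ M := hM.neg_mem

end IsMaximal

/-- Lindenbaum's lemma. -/
theorem exists_isMaximal_notMem (h : ¬ Derivable X φ) : ∃ M, IsMaximal X M ∧ φ ∉ M := by
  -- Theories closed under modus ponens that omit `φ`; a maximal one decides every formula.
  let S : Set (Set (Form P)) := {T | (∀ α, Derivable X α → α ∈ T) ∧
    (∀ α β, imp α β ∈ T → α ∈ T → β ∈ T) ∧ φ ∉ T}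
  obtain ⟨M, -, hMS, hmax⟩ := zorn_subset_nonempty S (by
    intro c hc hchain hne
    refine ⟨⋃₀ c, ⟨?_, ?_, ?_⟩, fun s hs => Set.subset_sUnion_of_mem hs⟩
    · obtain ⟨T, hT⟩ := hne
      exact fun α hα => ⟨T, hT, (hc hT).1 α hα⟩
    · rintro α β ⟨T, hT, h₁⟩ ⟨T', hT', h₂⟩
      rcases hchain.total hT hT' with hle | hle
      · exact ⟨T', hT', (hc hT').2.1 α β (hle h₁) h₂⟩
      · exact ⟨T, hT, (hc hT).2.1 α β h₁ (hle h₂)⟩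
    · rintro ⟨T, hT, hφ⟩
      exact (hc hT).2.2 hφ) {α | Derivable X α} ⟨fun _ h => h, fun _ _ => .modusPonens, h⟩
  obtain ⟨hthm, hmp, hφ⟩ := hMS
  have taut : ∀ {α}, IsTautology α → α ∈ M := fun hα => hthm _ (.tautology hα)
  have vimp : ∀ {v : Form P → Prop}, (∀ α, v (neg α) ↔ ¬ v α) →
      (∀ α β, v (Form.or α β) ↔ v α ∨ v β) → ∀ α β, v (imp α β) ↔ (v α → v β) := by
    intro v hn ho α β
    rw [Form.imp, ho, hn]; tauto
  -- If `α ∉ M`, the theory generated by `M` and `α` contains `φ`.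
  have hext : ∀ α, α ∉ M → imp α φ ∈ M := by
    intro α hα
    by_contra hαφ
    refine hα (hmax (y := {β | imp α β ∈ M}) ⟨?_, ?_, hαφ⟩ ?_ ?_)
    · intro β hβ
      refine hmp β _ (taut fun v _ hn ho => ?_) (hthm β hβ)
      simp only [vimp hn ho]; tauto
    · intro β γ h₁ h₂
      refine hmp _ _ (hmp _ _ (taut (α := imp (imp α (imp β γ)) (imp (imp α β) (imp α γ)))
        fun v _ hn ho => ?_) h₁) h₂
      simp only [vimp hn ho]; tauto
    · intro β hβ
      refine hmp β _ (taut fun v _ hn ho => ?_) hβ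
      simp only [vimp hn ho]; tauto
    · refine taut fun v _ hn ho => ?_
      simp only [vimp hn ho]; tauto
  have hneg : ∀ {α}, neg α ∈ M ↔ α ∉ M := by
    intro α
    constructor
    · intro h₁ h₂
      refine hφ (hmp _ _ (hmp _ _ (taut (α := imp (neg α) (imp α φ)) fun v _ hn ho => ?_) h₁) h₂)
      simp only [vimp hn ho, hn]; tauto
    · intro h₁
      by_contra h₂
      refine hφ (hmp _ _ (hmp _ _ (taut (α := imp (imp α φ) (imp (imp (neg α) φ) φ))
        fun v _ hn ho => ?_) (hext _ h₁)) (hext _ h₂))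
      simp only [vimp hn ho, hn]; tauto
  refine ⟨M, ⟨hthm _, ?_, hneg, ?_⟩, hφ⟩
  · refine hneg.1 (taut fun v hb hn ho => ?_)
    rwa [hn]
  · intro α β
    constructor
    · intro h₁
      by_contra! ⟨h₂, h₃⟩
      refine h₃ (hmp _ _ (hmp _ _ (taut (α := imp (Form.or α β) (imp (neg α) β))
        fun v _ hn ho => ?_) h₁) (hneg.2 h₂))
      simp only [vimp hn ho, hn, ho]; tauto
    · rintro (h₁ | h₁)
      · refine hmp _ _ (taut fun v _ hn ho => ?_) h₁
        simp only [vimp hn ho, ho]; tauto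
      · refine hmp _ _ (taut fun v _ hn ho => ?_) h₁
        simp only [vimp hn ho, ho]; tauto

theorem derivable_of_forall_mem (h : ∀ M, IsMaximal X M → φ ∈ M) : Derivable X φ := by
  by_contra hn
  obtain ⟨M, hM, hφ⟩ := exists_isMaximal_notMem hn
  exact hφ (h M hM)

/-- Every maximal consistent theory satisfies the rule of comparative possibility, with `⊥` added
to the disjuncts so that there may be none. -/
theorem IsMaximal.comparative_mem (hM : IsMaximal X M) {ι : Type*} [Finite ι] (δ : ι → Form P)
    (h : ∀ N, IsMaximal X N → φ ∈ N → ∃ i, δ i ∈ N) :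
    le bot φ ∈ M ∨ ∃ i, le (δ i) φ ∈ M := by
  classical
  have := Fintype.ofFinite ι
  have hd := hM.mem_of_derivable (Derivable.comparative (X := X) (φ := φ)
    (bot :: (Finset.univ : Finset ι).toList.map δ) (List.cons_ne_nil _ _)
    (derivable_of_forall_mem fun N hN => hN.imp_mem.2 fun hφ => hN.disj_mem.2 (by
      obtain ⟨i, hi⟩ := h N hN hφ
      exact ⟨δ i, by simp, hi⟩)))
  obtain ⟨χ, hχ, hχM⟩ := hM.disj_mem.1 hd
  simp only [List.map_cons, List.map_map, List.mem_cons, List.mem_map, Finset.mem_toList,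
    Finset.mem_univ, true_and, Function.comp_apply] at hχ
  rcases hχ with rfl | ⟨i, rfl⟩
  · exact .inl hχM
  · exact .inr ⟨i, hχM⟩

/-- `φ ≼ ψ` whenever `ψ` entails `φ`. -/
theorem IsMaximal.le_mem_of_entails (hM : IsMaximal X M)
    (h : ∀ N, IsMaximal X N → ψ ∈ N → φ ∈ N) : le φ ψ ∈ M := by
  have hd := hM.mem_of_derivable (Derivable.comparative (X := X) (φ := ψ) [φ]
    (List.cons_ne_nil _ _) (derivable_of_forall_mem fun N hN => hN.imp_mem.2 fun hψ =>
      hN.disj_mem.2 ⟨φ, by simp, h N hN hψ⟩))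
  obtain ⟨χ, hχ, hχM⟩ := hM.disj_mem.1 hd
  obtain rfl : χ = le φ ψ := by simpa using hχ
  exact hχM

end Theories

/-! ### The finite canonical model -/

section Canonical

open Form

variable {P : Type u} {W : Type v} {X : Semantics}

/-- A choice `m` of representatives of the maximal consistent theories modulo agreement on the
finite set `S`. -/
structure IsRepresentatives (X : Semantics) (S : Finset (Form P)) (m : W → Set (Form P)) :
    Prop where
  isMaximal : ∀ w, IsMaximal X (m w)
  exists_eq : ∀ M, IsMaximal X M → ∃ w, ∀ γ ∈ S, γ ∈ M ↔ γ ∈ m w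
  unique : ∀ w v, (∀ γ ∈ S, γ ∈ m w ↔ γ ∈ m v) → w = v

open Classical in
/-- The formula that describes which members of `S` belong to the theory `m w`. -/
noncomputable def stateDescription (S : Finset (Form P)) (m : W → Set (Form P)) (w : W) : Form P :=
  agree (S.filter (· ∈ m w)) S

theorem IsMaximal.stateDescription_mem {M : Set (Form P)} (hM : IsMaximal X M)
    {S : Finset (Form P)} {m : W → Set (Form P)} {w : W} :
    stateDescription S m w ∈ M ↔ ∀ γ ∈ S, γ ∈ M ↔ γ ∈ m w := by
  rw [stateDescription, hM.agree_mem]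
  exact forall₂_congr fun γ hγ => by simp [hγ]

/-- A variable is true at the worlds whose theory contains it. -/
def canonicalValuation (m : W → Set (Form P)) (p : P) : Set W :=
  {w | Form.var p ∈ m w}

/-- The representatives exist in every universe, since there are finitely many of them. -/
theorem exists_isRepresentatives (X : Semantics) (S : Finset (Form P)) :
    ∃ (W : Type v) (m : W → Set (Form P)), IsRepresentatives X S m := by
  classical
  let r : {M : Set (Form P) // IsMaximal X M} → S.powerset :=
    fun M => ⟨S.filter (· ∈ M.1), by simp⟩
  obtain ⟨n, ⟨e⟩⟩ := Finite.exists_equiv_fin (Set.range r)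
  have hr : ∀ M N, r M = r N ↔ ∀ γ ∈ S, γ ∈ M.1 ↔ γ ∈ N.1 := by
    intro M N
    simp only [r, Subtype.mk.injEq, Finset.ext_iff, Finset.mem_filter]
    exact forall_congr' fun γ => by tauto
  choose f hf using fun i : Set.range r => i.2
  refine ⟨ULift.{v} (Fin n), fun i => (f (e.symm i.down)).1, fun i => (f _).2, ?_, ?_⟩
  · intro M hM
    refine ⟨⟨e ⟨r ⟨M, hM⟩, ⟨M, hM⟩, rfl⟩⟩, (hr ⟨M, hM⟩ _).1 ?_⟩
    rw [hf]
    simp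
  · intro i j hij
    have := (hr _ _).2 hij
    rw [hf, hf, Subtype.coe_inj] at this
    exact ULift.ext _ _ (e.symm.injective this)

namespace IsRepresentatives

variable {S : Finset (Form P)} {m : W → Set (Form P)} (hm : IsRepresentatives X S m)

include hm

theorem finite : Finite W := by
  classical
  refine Finite.of_injective (β := S.powerset) (fun w => ⟨S.filter (· ∈ m w), by simp⟩) ?_
  intro w v h
  simp only [Subtype.mk.injEq, Finset.ext_iff, Finset.mem_filter] at h
  exact hm.unique w v fun γ hγ => by have := h γ; tauto

theorem stateDescription_mem_iff {w v : W} : stateDescription S m v ∈ m w ↔ v = w :=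
  (hm.isMaximal w).stateDescription_mem.trans
    ⟨fun h => (hm.unique w v h).symm, fun h _ _ => h ▸ Iff.rfl⟩

/-- The canonical frame: similarity to `w` is comparative possibility of state descriptions
according to the theory `m w`. -/
def frame : ConditionalFrame W where
  dom w := {x | dia (stateDescription S m x) ∈ m w}
  le w x y := dia (stateDescription S m x) ∈ m w ∧ dia (stateDescription S m y) ∈ m w ∧
    le (stateDescription S m x) (stateDescription S m y) ∈ m w
  le_dom _ _ _ h := ⟨h.1, h.2.1⟩
  self_mem w := (hm.isMaximal w).dia_mem.2 ((hm.isMaximal w).le_notMem_of_mem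
    (hm.stateDescription_mem_iff.2 rfl) (hm.isMaximal w).bot_notMem)
  refl w x hx := ⟨hx, hx, (or_self_iff).1 ((hm.isMaximal w).le_total_mem _ _)⟩
  trans w _ _ _ h₁ h₂ := ⟨h₁.1, h₂.2.1, (hm.isMaximal w).le_trans_mem h₁.2.2 h₂.2.2⟩
  total w x hx y hy := ((hm.isMaximal w).le_total_mem (stateDescription S m x)
    (stateDescription S m y)).imp (fun h => ⟨hx, hy, h⟩) (fun h => ⟨hy, hx, h⟩)
  centered w x hx hne := by
    have hn : le (stateDescription S m x) (stateDescription S m w) ∉ m w :=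
      (hm.isMaximal w).le_notMem_of_mem (hm.stateDescription_mem_iff.2 rfl)
        fun h => hne (hm.stateDescription_mem_iff.1 h)
    have hw : dia (stateDescription S m w) ∈ m w :=
      (hm.isMaximal w).dia_mem.2 ((hm.isMaximal w).le_notMem_of_mem
        (hm.stateDescription_mem_iff.2 rfl) (hm.isMaximal w).bot_notMem)
    exact ⟨⟨hw, hx, ((hm.isMaximal w).le_total_mem _ _).resolve_right hn⟩, fun h => hn h.2.2⟩
  limit w A hA hne := by
    have := hm.finite
    let _ : Preorder W :=
      { le := fun x y => le (stateDescription S m x) (stateDescription S m y) ∈ m w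
        le_refl := fun x => (or_self_iff).1 ((hm.isMaximal w).le_total_mem _ _)
        le_trans := fun _ _ _ => (hm.isMaximal w).le_trans_mem }
    obtain ⟨x, hx⟩ := (Set.toFinite A).exists_minimal hne
    exact ⟨x, ⟨hx.1, hA hx.1⟩, fun y hy h => h.2 ⟨h.1.2.1, h.1.1, hx.2 hy.1 h.1.2.2⟩⟩

/-- The truth lemma for `φ`: at each world of the canonical model `φ` is true if and only if it
belongs to the theory of the world. -/
def TruthLemma (φ : Form P) : Prop :=
  ∀ w, w ∈ φ.truth X hm.frame (canonicalValuation m) ↔ φ ∈ m w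

/-- The truth lemma for every maximal consistent theory that a world represents, not only for the
chosen one. It holds for the Boolean combinations of members of `S`, whereas comparisons of
possibility have in general only `TruthLemma`. -/
def UniformTruthLemma (φ : Form P) : Prop :=
  ∀ w M, IsMaximal X M → stateDescription S m w ∈ M →
    (w ∈ φ.truth X hm.frame (canonicalValuation m) ↔ φ ∈ M)

variable {hm} {φ ψ : Form P}

theorem UniformTruthLemma.truthLemma (h : hm.UniformTruthLemma φ) : hm.TruthLemma φ :=
  fun w => h w _ (hm.isMaximal w) (hm.stateDescription_mem_iff.2 rfl)

/-- For members of `S` the two forms of the truth lemma are equivalent. -/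
theorem TruthLemma.uniformTruthLemma (h : hm.TruthLemma φ) (hφ : φ ∈ S) :
    hm.UniformTruthLemma φ :=
  fun w _ hM hw => (h w).trans (hM.stateDescription_mem.1 hw φ hφ).symm

theorem UniformTruthLemma.bot : hm.UniformTruthLemma Form.bot :=
  fun _ _ hM _ => iff_of_false not_mem_truth_bot hM.bot_notMem

theorem UniformTruthLemma.neg (h : hm.UniformTruthLemma φ) : hm.UniformTruthLemma φ.neg :=
  fun w M hM hw => by rw [mem_truth_neg, hM.neg_mem, h w M hM hw]

theorem UniformTruthLemma.or (h₁ : hm.UniformTruthLemma φ) (h₂ : hm.UniformTruthLemma ψ) :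
    hm.UniformTruthLemma (φ.or ψ) :=
  fun w M hM hw => by rw [mem_truth_or, hM.or_mem, h₁ w M hM hw, h₂ w M hM hw]

theorem UniformTruthLemma.and (h₁ : hm.UniformTruthLemma φ) (h₂ : hm.UniformTruthLemma ψ) :
    hm.UniformTruthLemma (φ.and ψ) :=
  fun w M hM hw => by rw [mem_truth_and, hM.and_mem, h₁ w M hM hw, h₂ w M hM hw]

theorem UniformTruthLemma.disj_map {α : Type*} {A : Finset α} {f : α → Form P}
    (h : ∀ i ∈ A, hm.UniformTruthLemma (f i)) :
    hm.UniformTruthLemma (disj (A.toList.map f)) := fun w M hM hw => by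
  rw [mem_truth_disj_map, hM.disj_map_mem]
  exact exists_congr fun i => and_congr_right fun hi => h i hi w M hM hw

theorem UniformTruthLemma.agree {s t : Finset (Form P)}
    (h : ∀ γ ∈ t, hm.UniformTruthLemma γ) : hm.UniformTruthLemma (agree s t) :=
  fun w M hM hw => by
    rw [mem_truth_agree, hM.agree_mem]
    exact forall₂_congr fun γ hγ => by rw [h γ hγ w M hM hw]

theorem TruthLemma.neg (h : hm.TruthLemma φ) : hm.TruthLemma φ.neg :=
  fun w => by rw [mem_truth_neg, (hm.isMaximal w).neg_mem, h w]

theorem TruthLemma.imp (h₁ : hm.TruthLemma φ) (h₂ : hm.TruthLemma ψ) :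
    hm.TruthLemma (φ.imp ψ) :=
  fun w => by rw [mem_truth_imp, (hm.isMaximal w).imp_mem, h₁ w, h₂ w]

theorem TruthLemma.conj_map {α : Type*} {A : Finset α} {f : α → Form P}
    (h : ∀ i ∈ A, hm.TruthLemma (f i)) : hm.TruthLemma (conj (A.toList.map f)) := fun w => by
  rw [mem_truth_conj_map, (hm.isMaximal w).conj_map_mem]
  exact forall₂_congr fun i hi => h i hi w

/-- The heart of completeness: each comparandum is equivalent to the disjunction of the state
descriptions of the worlds at which it is true, and the rule of comparative possibility reduces
its comparisons to those of state descriptions, which the canonical frame decides. -/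
theorem TruthLemma.le (hφ : hm.UniformTruthLemma φ) (hψ : hm.UniformTruthLemma ψ) :
    hm.TruthLemma (le φ ψ) := by
  intro w
  have := hm.finite
  have hw := hm.isMaximal w
  -- A world at which `χ` is true is at least as remote as `χ`.
  have hle : ∀ {χ}, hm.UniformTruthLemma χ → ∀ {x},
      x ∈ χ.truth X hm.frame (canonicalValuation m) → Form.le χ (stateDescription S m x) ∈ m w :=
    fun hχ _ hx => hw.le_mem_of_entails fun N hN hxN => (hχ _ N hN hxN).1 hx
  -- Some world at which `χ` is true is no more remote than `χ`, unless `χ` is impossible.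
  have hex : ∀ {χ}, hm.UniformTruthLemma χ → Form.le Form.bot χ ∈ m w ∨
      ∃ x, x ∈ χ.truth X hm.frame (canonicalValuation m) ∧
        Form.le (stateDescription S m x) χ ∈ m w := by
    intro χ hχ
    refine (hw.comparative_mem (fun x : {x // x ∈ χ.truth X hm.frame (canonicalValuation m)} =>
      stateDescription S m x.1) fun N hN hχN => ?_).imp_right fun ⟨x, hx⟩ => ⟨x.1, x.2, hx⟩
    obtain ⟨x, hx⟩ := hm.exists_eq N hN
    have hxN : stateDescription S m x ∈ N := hN.stateDescription_mem.2 hx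
    exact ⟨⟨x, (hχ x N hN hxN).2 hχN⟩, hxN⟩
  rw [mem_truth_le]
  constructor
  · intro h
    rcases hex hψ with h₁ | ⟨y, hyψ, hy⟩
    · exact hw.le_trans_mem (hw.le_mem_of_entails fun N hN hb => absurd hb hN.bot_notMem) h₁
    · by_cases hyd : dia (stateDescription S m y) ∈ m w
      · obtain ⟨x, -, hxφ, hxy⟩ := h y hyd hyψ
        exact hw.le_trans_mem (hle hφ hxφ) (hw.le_trans_mem hxy.2.2 hy)
      · rw [hw.dia_mem, not_not] at hyd
        exact hw.le_trans_mem (hw.le_mem_of_entails fun N hN hb => absurd hb hN.bot_notMem)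
          (hw.le_trans_mem hyd hy)
  · intro h y hyd hyψ
    have hφy := hw.le_trans_mem h (hle hψ hyψ)
    have hyd' : Form.le Form.bot (stateDescription S m y) ∉ m w := hw.dia_mem.1 hyd
    rcases hex hφ with h₁ | ⟨x, hxφ, hx⟩
    · exact absurd (hw.le_trans_mem h₁ hφy) hyd'
    · have hxy := hw.le_trans_mem hx hφy
      have hxd : dia (stateDescription S m x) ∈ m w :=
        hw.dia_mem.2 fun hb => hyd' (hw.le_trans_mem hb hxy)
      exact ⟨x, hxd, hxφ, hxd, hyd, hxy⟩

theorem TruthLemma.dia (h : hm.UniformTruthLemma φ) : hm.TruthLemma (dia φ) :=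
  (TruthLemma.le .bot h).neg

theorem TruthLemma.compWould (hφ : hm.UniformTruthLemma φ) (hψ : hm.UniformTruthLemma ψ) :
    hm.TruthLemma (compWould φ ψ) :=
  (TruthLemma.dia hφ).imp (TruthLemma.le (hφ.and hψ.neg) (hφ.and hψ)).neg

theorem TruthLemma.reduct {Γ : Finset (Form P)} (hφ : hm.UniformTruthLemma φ)
    (hΓ : ∀ γ ∈ Γ, hm.UniformTruthLemma γ) (hψ : hm.UniformTruthLemma ψ) :
    hm.TruthLemma (reduct X φ Γ ψ) := by
  classical
  have hag : ∀ {s t}, t ⊆ Γ → hm.UniformTruthLemma (Form.agree s t) :=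
    fun ht => UniformTruthLemma.agree fun γ hγ => hΓ γ (ht hγ)
  refine TruthLemma.conj_map fun s hs => (hag subset_rfl).truthLemma.imp ?_
  cases X with
  | CP => exact TruthLemma.compWould (hφ.and (hag subset_rfl)) hψ
  | NC =>
    refine TruthLemma.conj_map fun t ht => (TruthLemma.conj_map fun t' ht' => ?_).imp ?_
    · simp only [Finset.mem_filter, Finset.mem_powerset] at ht'
      exact (TruthLemma.dia (hφ.and (hag ht'.1))).neg
    · refine TruthLemma.compWould (hφ.and (UniformTruthLemma.disj_map fun t' ht' => ?_)) hψ
      simp only [Finset.mem_filter, Finset.mem_powerset] at ht'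
      exact hag ht'.1
  | MS =>
    refine TruthLemma.conj_map fun t ht => (TruthLemma.conj_map fun t' ht' => ?_).imp ?_
    · simp only [Finset.mem_filter, Finset.mem_powerset] at ht'
      exact (TruthLemma.dia (hφ.and (hag ht'.1))).neg
    · exact TruthLemma.compWould (hφ.and (hag (Finset.mem_powerset.1 ht))) hψ

theorem TruthLemma.cond {Γ : Finset (Form P)} (hφ : hm.UniformTruthLemma φ)
    (hΓ : ∀ γ ∈ Γ, hm.UniformTruthLemma γ) (hψ : hm.UniformTruthLemma ψ) :
    hm.TruthLemma (cond φ Γ ψ) := fun w => by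
  rw [← truth_reduct, TruthLemma.reduct hφ hΓ hψ w]
  exact ((hm.isMaximal w).iff_mem.1 ((hm.isMaximal w).mem_of_derivable (.reduction φ Γ ψ))).symm

end IsRepresentatives

/-- Every formula satisfies the truth lemma once `S` contains the variables and the conditionals
from which it is built. -/
theorem exists_uniformTruthLemma (X : Semantics) (φ : Form P) :
    ∃ S₀ : Finset (Form P), ∀ S, S₀ ⊆ S → ∀ (W : Type v) (m : W → Set (Form P))
      (hm : IsRepresentatives X S m), hm.UniformTruthLemma φ := by
  classical
  induction φ using Form.induction with
  | var p =>
    refine ⟨{Form.var p}, fun S hS W m hm => IsRepresentatives.TruthLemma.uniformTruthLemma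
      (fun w => ?_) (Finset.singleton_subset_iff.1 hS)⟩
    rw [truth_var]
    exact Iff.rfl
  | bot => exact ⟨∅, fun _ _ _ _ _ => .bot⟩
  | neg φ ih =>
    obtain ⟨S₀, h⟩ := ih
    exact ⟨S₀, fun S hS W m hm => (h S hS W m hm).neg⟩
  | or φ ψ ih₁ ih₂ =>
    obtain ⟨S₁, h₁⟩ := ih₁
    obtain ⟨S₂, h₂⟩ := ih₂
    exact ⟨S₁ ∪ S₂, fun S hS W m hm =>
      (h₁ S (Finset.union_subset_left hS) W m hm).or (h₂ S (Finset.union_subset_right hS) W m hm)⟩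
  | cond φ Γ ψ ih₁ ih₂ ih₃ =>
    obtain ⟨S₁, h₁⟩ := ih₁
    obtain ⟨S₃, h₃⟩ := ih₃
    choose! S₂ h₂ using ih₂
    refine ⟨insert (cond φ Γ ψ) (S₁ ∪ S₃ ∪ Γ.biUnion S₂), fun S hS W m hm => ?_⟩
    obtain ⟨hc, hS⟩ := Finset.insert_subset_iff.1 hS
    obtain ⟨hS, hS₂⟩ := Finset.union_subset_iff.1 hS
    obtain ⟨hS₁, hS₃⟩ := Finset.union_subset_iff.1 hS
    exact (IsRepresentatives.TruthLemma.cond (h₁ S hS₁ W m hm)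
      (fun γ hγ => h₂ γ hγ S ((Finset.subset_biUnion_of_mem S₂ hγ).trans hS₂) W m hm)
      (h₃ S hS₃ W m hm)).uniformTruthLemma hc

/-! ### Completeness -/

theorem derivable_of_mem_logic {φ : Form P} (h : φ ∈ logic.{u, v} P X) : Derivable X φ := by
  refine derivable_of_forall_mem fun M hM => ?_
  obtain ⟨S, hS⟩ := exists_uniformTruthLemma.{u, v} X φ
  obtain ⟨W, m, hm⟩ := exists_isRepresentatives.{u, v} X S
  obtain ⟨w, hw⟩ := hm.exists_eq M hM
  have : Nonempty W := ⟨w⟩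
  exact (hS S subset_rfl W m hm w M hM (hM.stateDescription_mem.2 hw)).1
    (h W hm.frame (canonicalValuation m) w)

end Canonical

end CeterisParibus

theorem mainTheorem1 (P : Type u) (X : CeterisParibus.Semantics) :
    {φ : CeterisParibus.Form P | CeterisParibus.Derivable X φ} =
      CeterisParibus.logic.{u, v} P X := by
  ext φ
  exact ⟨fun h _ _ F V w => CeterisParibus.Derivable.sound h F V w,
    CeterisParibus.derivable_of_mem_logic⟩
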